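/- Let $\mathcal G$ be a weighted digraph on $n$ agents with adjacency matrix $A=(a_{ij})$, $a_{ij}\ge 0$, $a_{ii}=0$ (there is a link from agent $j$ to agent $i$ iff $a_{ij}>0$), and Laplacian $L=\mathrm{diag}\big(\sum_j a_{1j},\dots,\sum_j a_{nj}\big)-A$. Assume that $\mathcal G$ is strongly connected, and let $\xi\in\mathbb R^n$ be the vector with $\xi_i\ge 0$, $\sum_i\xi_i=1$ and $\xi^\top L=0$. Let $h>0$ and let $g(s)=(g_1(s_1),\dots,g_p(s_p))$ for $s\in\mathbb R^p$, where every $g_l:\mathbb R\to\mathbb R$ is continuous, nondecreasing on $\mathbb R$, strictly increasing on $[-h,h]$, Lipschitz on every compact set, and satisfies $g_l(s)=0$ iff $s=0$. Let $\alpha_i>0$, $\beta_i>0$ for $i=1,\dots,n$. Consider the agents $\dot x_i(t)=u_i(t)$, $x_i(t)\in\mathbb R^p$, with the event-triggered protocol $$u_i(t)=-\sum_{j=1}^n L_{ij}\,g\big(x_j(t^j_{k_j(t)})\big),\qquad k_j(t)=\max\{k: t^j_k\le t\},$$ where $t^i_1=0$ and $$t^i_{k+1}=\max\Big\{r\ge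 t^i_k:\ \big\|g(x_i(t^i_k))-g(x_i(t))\big\|^2\le \alpha_i e^{-\beta_i t}\ \text{ for all } t\in[t^i_k,r]\Big\},$$ with $t^i_{k+1}=\infty$ (agent $i$ does not trigger again) if the inequality is never about to be violated. The closed loop is run from an arbitrary initial state up to the first time, if any, at which the triggering times of some agent accumulate. Put $\bar x(t)=\sum_i\xi_i x_i(t)$. Then: (i) there is no Zeno behaviour: the closed loop runs on all of $[0,\infty)$ and every agent triggers only finitely many times in every bounded time interval; (ii) if $|\bar x_l(0)|\le h$ for every $l=1,\dots,p$, then $\lim_{t\to\infty}x_i(t)=\bar x(0)$ for every $i$, i.e. consensus is achieved with consensus value $\bar x(0)$. -/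

import Mathlib

namespace EventTriggered

open Set

/-- A weighted digraph on the agents `0, …, n-1`: `weight i j > 0` iff there is a link from
agent `j` to agent `i`. -/
structure WeightedDigraph (n : ℕ) where
  weight : Matrix (Fin n) (Fin n) ℝ
  weight_nonneg : ∀ i j, 0 ≤ weight i j
  weight_self : ∀ i, weight i i = 0

namespace WeightedDigraph

variable {n : ℕ}

/-- There is a link from `i` to `j`. -/
def Link (G : WeightedDigraph n) (i j : Fin n) : Prop := 0 < G.weight j i

/-- Any agent can be reached from any other one along directed links. -/
def StronglyConnected (G : WeightedDigraph n) : Prop :=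
  ∀ i j, i ≠ j → Relation.TransGen G.Link i j

/-- In-degree of agent `i`. -/
def inDegree (G : WeightedDigraph n) (i : Fin n) : ℝ := ∑ j, G.weight i j

/-- The Laplacian: in-degree matrix minus adjacency matrix. -/
def laplacian (G : WeightedDigraph n) : Matrix (Fin n) (Fin n) ℝ :=
  Matrix.diagonal G.inDegree - G.weight

/-- `ξ` is a nonnegative left null vector of the Laplacian whose entries sum to one. -/
structure IsLeftWeight (G : WeightedDigraph n) (ξ : Fin n → ℝ) : Prop where
  nonneg : ∀ i, 0 ≤ ξ i
  sum_eq_one : ∑ i, ξ i = 1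
  vecMul_laplacian : Matrix.vecMul ξ G.laplacian = 0

end WeightedDigraph

/-- The assumptions on the scalar output functions `g_1, …, g_p`. -/
structure OutputAssumption {p : ℕ} (g : Fin p → ℝ → ℝ) (h : ℝ) : Prop where
  continuous : ∀ l, Continuous (g l)
  monotone : ∀ l, Monotone (g l)
  strictMonoOn : ∀ l, StrictMonoOn (g l) (Icc (-h) h)
  eq_zero_iff : ∀ l s, g l s = 0 ↔ s = 0
  locallyLipschitz : ∀ l (S : Set ℝ), IsCompact S → ∃ K : NNReal, LipschitzOnWith K (g l) S

variable {n p : ℕ}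

/-- The componentwise output map `s ↦ (g_1 (s_1), …, g_p (s_p))` of `ℝ^p`. -/
noncomputable def output (g : Fin p → ℝ → ℝ) (s : EuclideanSpace ℝ (Fin p)) :
    EuclideanSpace ℝ (Fin p) :=
  WithLp.toLp 2 (fun l => g l (s l))

/-- The index of the last triggering time not after `τ`: the largest `k` with `t_k ≤ τ`. -/
noncomputable def lastIndex (t : ℕ → EReal) (τ : ℝ) : ℕ :=
  sSup {k : ℕ | t k ≤ (τ : EReal)}

/-- The state of an agent at its last triggering time not after `τ`. -/
noncomputable def sampledState (x : ℝ → EuclideanSpace ℝ (Fin p)) (t : ℕ → EReal) (τ : ℝ) :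
    EuclideanSpace ℝ (Fin p) :=
  x (t (lastIndex t τ)).toReal

/-- The event-triggered input `u_i(τ) = - ∑ j, L_ij g(x_j(t^j_{k_j(τ)}))`. -/
noncomputable def controlInput (G : WeightedDigraph n) (g : Fin p → ℝ → ℝ)
    (x : Fin n → ℝ → EuclideanSpace ℝ (Fin p)) (t : Fin n → ℕ → EReal) (i : Fin n) (τ : ℝ) :
    EuclideanSpace ℝ (Fin p) :=
  -∑ j, G.laplacian i j • output g (sampledState (x j) (t j) τ)

/-- The first time at which the triggering times of some agent accumulate, and `⊤` if this never
happens. The closed loop runs on `[0, horizon t)`; beyond it the index of the last triggering time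
of some agent makes no sense. -/
noncomputable def horizon (t : Fin n → ℕ → EReal) : EReal := ⨅ i, ⨆ k, t i k

/-- The times `r ∈ [s, T)` such that an agent with trajectory `y` that triggered at time `s`, and
has held the output `g (y s)` since then, satisfies `‖e(τ)‖² ≤ a e^{-b τ}` on all of `[s, r]`. -/
def admissibleTimes (g : Fin p → ℝ → ℝ) (a b : ℝ) (T : EReal)
    (y : ℝ → EuclideanSpace ℝ (Fin p)) (s : ℝ) : Set ℝ :=
  {r | s ≤ r ∧ (r : EReal) < T ∧
    ∀ τ ∈ Icc s r, ‖output g (y s) - output g (y τ)‖ ^ 2 ≤ a * Real.exp (-b * τ)}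

/-- `x` (states) and `t` (triggering times, numbered from `0`) form an execution of the closed
loop, run up to the first accumulation of triggering times. The value `t i k = ⊤` means that agent
`i` triggers at most `k` times. Nothing is required of `x` outside `[0, horizon t)`, and no limit at
`horizon t` is presupposed.

As the input is piecewise constant and right continuous, `ẋ_i = u_i` is stated as a right
derivative at every time, together with continuity of `x_i`. -/
structure IsExecution (G : WeightedDigraph n) (g : Fin p → ℝ → ℝ) (α β : Fin n → ℝ)
    (x : Fin n → ℝ → EuclideanSpace ℝ (Fin p)) (t : Fin n → ℕ → EReal) : Prop where
  first : ∀ i, t i 0 = 0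
  /-- The next triggering time is the largest admissible time; if the inequality is never about
  to be violated, there is none. -/
  next : ∀ i k (s : ℝ), t i k = (s : EReal) →
    (∃ r : ℝ, IsGreatest (admissibleTimes g (α i) (β i) (horizon t) (x i) s) r ∧
      t i (k + 1) = (r : EReal)) ∨
    ((∀ r : ℝ, s ≤ r → (r : EReal) < horizon t →
      r ∈ admissibleTimes g (α i) (β i) (horizon t) (x i) s) ∧ t i (k + 1) = ⊤)
  next_top : ∀ i k, t i k = ⊤ → t i (k + 1) = ⊤
  continuousOn : ∀ i, ContinuousOn (x i) {τ : ℝ | 0 ≤ τ ∧ (τ : EReal) < horizon t}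
  deriv_right : ∀ i (τ : ℝ), 0 ≤ τ → (τ : EReal) < horizon t →
    HasDerivWithinAt (x i) (controlInput G g x t i τ) (Ici τ) τ

/-- No Zeno behaviour: the closed loop runs for all times, and each agent triggers only finitely
often in bounded time. -/
def NoZeno (t : Fin n → ℕ → EReal) : Prop :=
  horizon t = ⊤ ∧ ∀ i (S : ℝ), {k : ℕ | t i k ≤ (S : EReal)}.Finite

/-- The weighted average `∑ i, ξ_i x_i(τ)`. -/
noncomputable def weightedAverage (ξ : Fin n → ℝ) (x : Fin n → ℝ → EuclideanSpace ℝ (Fin p))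
    (τ : ℝ) : EuclideanSpace ℝ (Fin p) :=
  ∑ i, ξ i • x i τ

end EventTriggered

/-! The coordinates decouple. Writing `e` for sampled minus current output, each one is a scalar
consensus flow driven by `f (y j) + e j`, and the triggering rule gives `|e i τ| ≤ A * exp (-b * τ)`
(`exists_isPerturbedFlow`).

An agent with the largest state is pushed upwards only by the errors, which are integrable in time.
Hence states stay bounded on `[0, T)` even when `T` is a finite horizon, and outputs are Lipschitz
there. Before a finite `T` the threshold is bounded below, so an output needs a minimal time to
reach it. This dwell time forbids accumulation (`horizon_eq_top`).

On `[0, ∞)` the energy `∑ i, ξ i * ∫ f` over `[0, y i]` dissipates the weighted output disagreement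
up to an exponentially small term, so outputs synchronise by a Barbalat argument
(`tendsto_output_sub`). The `ξ`-average is conserved. A cluster point thus has equal outputs and an
average in `[-h, h]`, which leaves only the consensus point (`eq_average_of_forall_eq`); compactness
gives convergence. -/

open Set Filter Topology

namespace EventTriggered

variable {n p : ℕ}

/-! ### The Laplacian and its left null vector -/

namespace WeightedDigraph

lemma neg_sum_laplacian_mul (G : WeightedDigraph n) (v : Fin n → ℝ) (i : Fin n) :
    -∑ j, G.laplacian i j * v j = ∑ j, G.weight i j * (v j - v i) := by
  simp [laplacian, sub_mul, mul_sub, Finset.sum_sub_distrib, inDegree, Matrix.diagonal_apply,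
    Finset.sum_mul]

namespace IsLeftWeight

variable {G : WeightedDigraph n} {ξ : Fin n → ℝ}

lemma sum_mul_sum_weight (hξ : G.IsLeftWeight ξ) (v : Fin n → ℝ) :
    ∑ i, ξ i * ∑ j, G.weight i j * (v j - v i) = 0 := by
  have h1 : ∑ i, ξ i * ∑ j, G.laplacian i j * v j = 0 := by
    have h := congrArg (fun u => u ⬝ᵥ v) hξ.vecMul_laplacian
    simp only [zero_dotProduct] at h
    rw [← Matrix.dotProduct_mulVec] at h
    simpa [dotProduct, Matrix.mulVec] using h
  simp_rw [← neg_sum_laplacian_mul, mul_neg, Finset.sum_neg_distrib, h1, neg_zero]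

lemma sum_mul_weight (hξ : G.IsLeftWeight ξ) (j : Fin n) :
    ∑ i, ξ i * G.weight i j = ξ j * G.inDegree j := by
  have h := congrFun hξ.vecMul_laplacian j
  simp only [Matrix.vecMul, dotProduct, laplacian, Matrix.sub_apply, mul_sub,
    Finset.sum_sub_distrib, Matrix.diagonal_apply, Pi.zero_apply] at h
  simp at h
  linarith

/-- Zeros of `ξ` propagate along links: column `j` of `ξᵀL = 0` equates `∑ i, ξ i * a_ij` with a
multiple of `ξ j`, and its terms are nonnegative. One zero would spread to all agents, contradicting
total mass one. -/
lemma pos (hξ : G.IsLeftWeight ξ) (hG : G.StronglyConnected) (i : Fin n) : 0 < ξ i := by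
  refine (hξ.nonneg i).lt_of_ne' fun h0 => ?_
  have step : ∀ j k, ξ j = 0 → G.Link j k → ξ k = 0 := by
    intro j k hj hjk
    have h := hξ.sum_mul_weight j
    rw [hj, zero_mul, Finset.sum_eq_zero_iff_of_nonneg
      fun m _ => mul_nonneg (hξ.nonneg m) (G.weight_nonneg m j)] at h
    exact (mul_eq_zero.1 (h k (Finset.mem_univ k))).resolve_right (ne_of_gt hjk)
  have all : ∀ k, ξ k = 0 := by
    intro k
    rcases eq_or_ne i k with rfl | hne
    · exact h0
    · have hik := hG i k hne
      clear hne
      induction hik with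
      | single h => exact step _ _ h0 h
      | tail _ h ih => exact step _ _ ih h
  simpa [all] using hξ.sum_eq_one

end IsLeftWeight

end WeightedDigraph

/-! ### Perturbed scalar flows: a priori bounds and conservation -/

/-- A scalar consensus flow `ẏ_i = ∑ j, a_ij ((f(y_j) + e_j) - (f(y_i) + e_i))` on `[0, T)` whose
perturbations `e_i` decay exponentially. -/
structure IsPerturbedFlow (G : WeightedDigraph n) (f : ℝ → ℝ) (A b : ℝ) (T : EReal)
    (y e : Fin n → ℝ → ℝ) : Prop where
  continuousOn : ∀ i, ContinuousOn (y i) {τ : ℝ | 0 ≤ τ ∧ (τ : EReal) < T}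
  deriv_right : ∀ i (τ : ℝ), 0 ≤ τ → (τ : EReal) < T →
    HasDerivWithinAt (y i)
      (∑ j, G.weight i j * ((f (y j τ) + e j τ) - (f (y i τ) + e i τ))) (Ici τ) τ
  error_le : ∀ i (τ : ℝ), 0 ≤ τ → (τ : EReal) < T → |e i τ| ≤ A * Real.exp (-b * τ)

namespace IsPerturbedFlow

variable {G : WeightedDigraph n} {f : ℝ → ℝ} {A b : ℝ} {T : EReal} {y e : Fin n → ℝ → ℝ}

lemma Icc_subset {S : ℝ} (hS : (S : EReal) < T) {s : ℝ} (hs : 0 ≤ s) :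
    Icc s S ⊆ {τ : ℝ | 0 ≤ τ ∧ (τ : EReal) < T} := fun _ hτ =>
  ⟨hs.trans hτ.1, (EReal.coe_le_coe_iff.2 hτ.2).trans_lt hS⟩

/-- This symmetry turns upper bounds into lower bounds; `s ↦ -f (-s)` is again monotone. -/
protected lemma neg (H : IsPerturbedFlow G f A b T y e) :
    IsPerturbedFlow G (fun s => -f (-s)) A b T (fun i τ => -y i τ) (fun i τ => -e i τ) where
  continuousOn i := (H.continuousOn i).neg
  deriv_right i τ h0 hT := by
    refine (H.deriv_right i τ h0 hT).neg.congr_deriv ?_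
    rw [← Finset.sum_neg_distrib]
    refine Finset.sum_congr rfl fun j _ => ?_
    simp only [neg_neg]
    ring
  error_le i τ h0 hT := by simpa using H.error_le i τ h0 hT

/-- Barrier argument: an agent touching a common barrier `B` from below is a maximal one, so
monotonicity of `f` leaves only the error terms in its velocity. -/
lemma exists_upper_bound (H : IsPerturbedFlow G f A b T y e) (hf : Monotone f) (hA : 0 ≤ A)
    (hb : 0 < b) : ∃ R, ∀ i (τ : ℝ), 0 ≤ τ → (τ : EReal) < T → y i τ ≤ R := by
  obtain ⟨M, hM⟩ : ∃ M, ∀ i, y i 0 ≤ M := by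
    obtain ⟨M, hM⟩ := (finite_range fun i => y i 0).bddAbove
    exact ⟨M, fun i => hM ⟨i, rfl⟩⟩
  have hdeg : ∀ i j, 0 ≤ G.weight i j * (2 * A) := fun i j =>
    mul_nonneg (G.weight_nonneg i j) (by positivity)
  set C : ℝ := ∑ i, ∑ j, G.weight i j * (2 * A) with hC
  have hC0 : 0 ≤ C := Finset.sum_nonneg fun i _ => Finset.sum_nonneg fun j _ => hdeg i j
  -- `B` solves `B' = (C + 1) * exp (-b * τ)`, `B 0 = M`. The errors contribute at most `C * exp (-b
  -- * τ)`; the extra `1` makes the comparison strict at contact.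
  set B : ℝ → ℝ := fun τ => M + (C + 1) / b * (1 - Real.exp (-b * τ)) with hB
  have hBd : ∀ τ, HasDerivAt B ((C + 1) * Real.exp (-b * τ)) τ := by
    intro τ
    have h1 : HasDerivAt (fun τ : ℝ => -b * τ) (-b) τ := by
      simpa using (hasDerivAt_id τ).const_mul (-b)
    refine (((h1.exp.const_sub 1).const_mul ((C + 1) / b)).const_add M).congr_deriv ?_
    field_simp
  have hBc : Continuous B := continuous_iff_continuousAt.2 fun τ => (hBd τ).continuousAt
  have key : ∀ S : ℝ, 0 ≤ S → (S : EReal) < T → ∀ i, y i S ≤ B S := by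
    intro S hS hST
    suffices h : Icc 0 S ⊆ {τ | ∀ i, y i τ ≤ B τ} from h ⟨hS, le_rfl⟩
    -- Continuous induction: the set of good times is closed, contains `0`, and extends to the right
    -- of each of its points.
    refine IsClosed.Icc_subset_of_forall_mem_nhdsWithin ?_ ?_ ?_
    · have : {τ | ∀ i, y i τ ≤ B τ} ∩ Icc 0 S = Icc 0 S ∩ ⋂ i, {τ ∈ Icc 0 S | y i τ ≤ B τ} := by
        ext τ
        simp only [mem_inter_iff, mem_ofPred_eq, mem_iInter]
        grind
      rw [this]
      exact isClosed_Icc.inter (isClosed_iInter fun i => isClosed_Icc.isClosed_le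
        ((H.continuousOn i).mono (Icc_subset hST le_rfl)) hBc.continuousOn)
    · intro i
      simpa [hB] using hM i
    · rintro τ ⟨hτ, hτ0, hτS⟩
      have hτT : (τ : EReal) < T := (EReal.coe_lt_coe_iff.2 hτS).trans hST
      change ∀ᶠ σ in 𝓝[>] τ, ∀ i, y i σ ≤ B σ
      rw [eventually_all]
      intro i
      have hd := H.deriv_right i τ hτ0 hτT
      rcases (hτ i).lt_or_eq with hlt | heq
      · have hc : ContinuousWithinAt (fun σ => B σ - y i σ) (Ioi τ) τ :=
          (hBc.continuousWithinAt.sub hd.continuousWithinAt).mono Ioi_subset_Ici_self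
        filter_upwards [hc.eventually (lt_mem_nhds (sub_pos.2 hlt))] with σ hσ
        exact (sub_pos.1 hσ).le
      · have hdd := (hBd τ).hasDerivWithinAt.sub hd
        have hpos : 0 < (C + 1) * Real.exp (-b * τ) -
            ∑ j, G.weight i j * ((f (y j τ) + e j τ) - (f (y i τ) + e i τ)) := by
          have hE := Real.exp_pos (-b * τ)
          have h1 : ∑ j, G.weight i j * ((f (y j τ) + e j τ) - (f (y i τ) + e i τ)) ≤
              (∑ j, G.weight i j * (2 * A)) * Real.exp (-b * τ) := by
            rw [Finset.sum_mul]
            refine Finset.sum_le_sum fun j _ => ?_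
            rw [mul_assoc]
            refine mul_le_mul_of_nonneg_left ?_ (G.weight_nonneg i j)
            have h2 : f (y j τ) ≤ f (y i τ) := hf (by rw [heq]; exact hτ j)
            have h3 := abs_le.1 (H.error_le i τ hτ0 hτT)
            have h4 := abs_le.1 (H.error_le j τ hτ0 hτT)
            linarith [h3.1, h4.2]
          have h5 : ∑ j, G.weight i j * (2 * A) ≤ C :=
            Finset.single_le_sum (f := fun i => ∑ j, G.weight i j * (2 * A))
              (fun i _ => Finset.sum_nonneg fun j _ => hdeg i j) (Finset.mem_univ i)
          nlinarith
        rw [hasDerivWithinAt_iff_tendsto_slope] at hdd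
        rw [Ici_sdiff_left] at hdd
        filter_upwards [hdd.eventually (lt_mem_nhds hpos), self_mem_nhdsWithin] with σ hσ hσ'
        rw [slope_def_field] at hσ
        have := (div_pos_iff_of_pos_right (sub_pos.2 hσ')).1 hσ
        simp only [Pi.sub_apply] at this
        linarith
  refine ⟨M + (C + 1) / b, fun i τ h0 hT => (key τ h0 hT i).trans ?_⟩
  have : 0 ≤ (C + 1) / b * Real.exp (-b * τ) := by positivity
  simp only [hB]
  linarith

lemma exists_abs_le (H : IsPerturbedFlow G f A b T y e) (hf : Monotone f) (hA : 0 ≤ A)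
    (hb : 0 < b) : ∃ R, ∀ i (τ : ℝ), 0 ≤ τ → (τ : EReal) < T → |y i τ| ≤ R := by
  obtain ⟨R₁, h₁⟩ := H.exists_upper_bound hf hA hb
  obtain ⟨R₂, h₂⟩ := H.neg.exists_upper_bound
    (fun s r hsr => neg_le_neg (hf (neg_le_neg hsr))) hA hb
  refine ⟨max R₁ R₂, fun i τ h0 hT => abs_le'.2 ⟨?_, ?_⟩⟩
  · exact (h₁ i τ h0 hT).trans (le_max_left _ _)
  · exact (h₂ i τ h0 hT).trans (le_max_right _ _)

lemma error_le_const (H : IsPerturbedFlow G f A b T y e) (hA : 0 ≤ A) (hb : 0 < b) (i : Fin n)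
    {τ : ℝ} (h0 : 0 ≤ τ) (hT : (τ : EReal) < T) : |e i τ| ≤ A :=
  (H.error_le i τ h0 hT).trans (mul_le_of_le_one_right hA (Real.exp_le_one_iff.2 (by nlinarith)))

lemma exists_output_abs_le (H : IsPerturbedFlow G f A b T y e) (hf : Monotone f) (hA : 0 ≤ A)
    (hb : 0 < b) :
    ∃ F, 0 ≤ F ∧ ∀ i (τ : ℝ), 0 ≤ τ → (τ : EReal) < T → |f (y i τ)| ≤ F := by
  obtain ⟨R, hR⟩ := H.exists_abs_le hf hA hb
  exact ⟨max |f (-R)| |f R|, (abs_nonneg _).trans (le_max_left _ _), fun i τ h0 hT =>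
    abs_le_max_abs_abs (hf (abs_le.1 (hR i τ h0 hT)).1) (hf (abs_le.1 (hR i τ h0 hT)).2)⟩

lemma exists_lipschitz (H : IsPerturbedFlow G f A b T y e) (hf : Monotone f) (hA : 0 ≤ A)
    (hb : 0 < b) : ∃ V, 0 ≤ V ∧ ∀ i (s r : ℝ), 0 ≤ s → s ≤ r → (r : EReal) < T →
      |y i r - y i s| ≤ V * (r - s) := by
  obtain ⟨F, hF0, hF⟩ := H.exists_output_abs_le hf hA hb
  have hw : ∀ i j, 0 ≤ G.weight i j * (2 * (F + A)) := fun i j =>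
    mul_nonneg (G.weight_nonneg i j) (by positivity)
  refine ⟨∑ i, ∑ j, G.weight i j * (2 * (F + A)),
    Finset.sum_nonneg fun i _ => Finset.sum_nonneg fun j _ => hw i j, fun i s r hs hsr hr => ?_⟩
  have hsub := Icc_subset hr hs
  refine norm_image_sub_le_of_norm_deriv_right_le_segment ((H.continuousOn i).mono hsub)
    (fun τ hτ => H.deriv_right i τ (hsub (Ico_subset_Icc_self hτ)).1
      (hsub (Ico_subset_Icc_self hτ)).2) (fun τ hτ => ?_) r ⟨hsr, le_rfl⟩
  obtain ⟨h0, hT⟩ := hsub (Ico_subset_Icc_self hτ)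
  refine le_trans ?_ (Finset.single_le_sum (f := fun i => ∑ j, G.weight i j * (2 * (F + A)))
    (fun i _ => Finset.sum_nonneg fun j _ => hw i j) (Finset.mem_univ i))
  refine (norm_sum_le _ _).trans (Finset.sum_le_sum fun j _ => ?_)
  rw [norm_mul, Real.norm_of_nonneg (G.weight_nonneg i j)]
  refine mul_le_mul_of_nonneg_left ?_ (G.weight_nonneg i j)
  rw [Real.norm_eq_abs]
  have h1 := abs_le.1 (hF i τ h0 hT)
  have h2 := abs_le.1 (hF j τ h0 hT)
  have h3 := abs_le.1 (H.error_le_const hA hb i h0 hT)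
  have h4 := abs_le.1 (H.error_le_const hA hb j h0 hT)
  exact abs_le.2 ⟨by linarith [h1.1, h1.2, h2.1, h2.2, h3.1, h3.2, h4.1, h4.2],
    by linarith [h1.1, h1.2, h2.1, h2.2, h3.1, h3.2, h4.1, h4.2]⟩

/-- The errors enter through the same Laplacian as the outputs, so `ξ` annihilates them too. -/
lemma sum_mul_eq (H : IsPerturbedFlow G f A b ⊤ y e) {ξ : Fin n → ℝ} (hξ : G.IsLeftWeight ξ)
    {τ : ℝ} (hτ : 0 ≤ τ) : ∑ i, ξ i * y i τ = ∑ i, ξ i * y i 0 := by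
  refine constant_of_has_deriv_right_zero (f := fun τ => ∑ i, ξ i * y i τ) (a := 0) (b := τ)
    (continuousOn_finsetSum _ fun i _ => continuousOn_const.mul ((H.continuousOn i).mono
      (Icc_subset (EReal.coe_lt_top τ) le_rfl))) (fun s hs => ?_) τ ⟨hτ, le_rfl⟩
  convert HasDerivWithinAt.fun_sum (u := Finset.univ) fun i _ =>
    (H.deriv_right i s hs.1 (EReal.coe_lt_top s)).const_mul (ξ i) using 1
  exact (hξ.sum_mul_sum_weight fun j => f (y j s) + e j s).symm

end IsPerturbedFlow

/-! ### Two scalar tools: Barbalat and identification of the limit -/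

/-- Barbalat-type lemma: a function that is bounded below and decreases at rate at least `q`, up to
an exponentially decaying term, forces the Lipschitz function `q` to vanish at infinity. -/
lemma tendsto_zero_of_deriv_right_le {W W' q : ℝ → ℝ} {C b K m : ℝ} (hb : 0 < b)
    (hW : ContinuousOn W (Ici 0))
    (hW' : ∀ τ, 0 ≤ τ → HasDerivWithinAt W (W' τ) (Ici τ) τ)
    (hle : ∀ τ, 0 ≤ τ → W' τ ≤ -q τ + C * Real.exp (-b * τ)) (hm : ∀ τ, 0 ≤ τ → m ≤ W τ)
    (hq : ∀ τ, 0 ≤ τ → 0 ≤ q τ) (hC : 0 ≤ C) (hK : 0 ≤ K)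
    (hqK : ∀ s r, 0 ≤ s → s ≤ r → |q r - q s| ≤ K * (r - s)) :
    Tendsto q atTop (𝓝 0) := by
  -- The added term absorbs the exponential, so that `U' ≤ -q`.
  set U : ℝ → ℝ := fun τ => W τ + C / b * Real.exp (-b * τ) with hU
  have hUc : ContinuousOn U (Ici 0) := hW.add (by fun_prop)
  have hUd : ∀ τ, 0 ≤ τ →
      HasDerivWithinAt U (W' τ - C * Real.exp (-b * τ)) (Ici τ) τ := by
    intro τ hτ
    have h1 : HasDerivAt (fun τ : ℝ => -b * τ) (-b) τ := by
      simpa using (hasDerivAt_id τ).const_mul (-b)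
    refine ((hW' τ hτ).add (h1.exp.const_mul (C / b)).hasDerivWithinAt).congr_deriv ?_
    field_simp
    ring
  have decay : ∀ s r c, 0 ≤ s → s ≤ r → (∀ τ ∈ Ico s r, c ≤ q τ) →
      U r ≤ U s - c * (r - s) := by
    intro s r c hs hsr hc
    have hsub : Icc s r ⊆ Ici 0 := fun τ hτ => hs.trans hτ.1
    refine image_le_of_deriv_right_le_deriv_boundary (f := U) (B := fun r => U s - c * (r - s))
      (B' := fun _ => -c) (hUc.mono hsub) (fun τ hτ => hUd τ (hs.trans hτ.1)) (by simp)
      (by fun_prop) (fun τ _ => ?_) (fun τ hτ => ?_) ⟨hsr, le_rfl⟩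
    · have := (((hasDerivAt_id τ).sub_const s).const_mul c).const_sub (U s)
      simpa using this.hasDerivWithinAt
    · linarith [hle τ (hs.trans hτ.1), hc τ hτ]
  have hanti : Antitone fun τ => U (max τ 0) := by
    intro s r hsr
    have := decay (max s 0) (max r 0) 0 (le_max_right _ _) (max_le_max_right 0 hsr)
      fun τ hτ => hq τ ((le_max_right _ _).trans hτ.1)
    simpa using this
  have hbdd : BddBelow (range fun τ => U (max τ 0)) := by
    refine ⟨m, ?_⟩
    rintro _ ⟨τ, rfl⟩
    have := hm (max τ 0) (le_max_right _ _)
    have h2 : 0 ≤ C / b * Real.exp (-b * max τ 0) := by positivity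
    simp only [hU]
    linarith
  have hlim := tendsto_atTop_ciInf hanti hbdd
  rw [Metric.tendsto_atTop]
  intro ε hε
  -- If `q s ≥ ε`, then `q ≥ ε / 2` on `[s, s + δ)`, so `U` drops by at least `ε / 2 * δ`. Such
  -- drops are impossible at late times, as `U` converges. The `+ 1` covers `K = 0`.
  set δ : ℝ := ε / (2 * (K + 1)) with hδ
  have hδ0 : 0 < δ := by positivity
  have hdiff : Tendsto (fun τ => U (max τ 0) - U (max (τ + δ) 0)) atTop (𝓝 0) := by
    simpa using hlim.sub (hlim.comp (tendsto_atTop_add_const_right atTop δ tendsto_id))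
  obtain ⟨N, hN⟩ := eventually_atTop.1
    ((hdiff.eventually (gt_mem_nhds (show 0 < ε / 2 * δ by positivity))).and
      (eventually_ge_atTop 0))
  refine ⟨N, fun s hs => ?_⟩
  obtain ⟨h1, h0⟩ := hN s hs
  rw [max_eq_left h0, max_eq_left (by linarith)] at h1
  rw [Real.dist_eq, sub_zero, abs_of_nonneg (hq s h0)]
  by_contra! hcon
  have := decay s (s + δ) (ε / 2) h0 (by linarith) fun τ hτ => by
    have h3 := (abs_le.1 (hqK s τ h0 hτ.1)).1
    have h4 : K * (τ - s) ≤ K * δ := mul_le_mul_of_nonneg_left (by linarith [hτ.2]) hK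
    have h5 : K * δ ≤ ε / 2 := by
      have : (K + 1) * δ = ε / 2 := by rw [hδ]; field_simp
      nlinarith
    linarith
  linarith

/-- If all `f (z i)` agree and the average of the `z i` lies where `f` is strictly increasing, then
all `z i` agree with their average. -/
lemma eq_average_of_forall_eq {f : ℝ → ℝ} {h : ℝ} (hh : 0 < h) (hf : Monotone f)
    (hs : StrictMonoOn f (Icc (-h) h)) {ξ z : Fin n → ℝ} (hξ : ∀ i, 0 < ξ i)
    (hξ1 : ∑ i, ξ i = 1) {c : ℝ} (hc : |c| ≤ h) (hz : ∑ i, ξ i * z i = c)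
    (heq : ∀ i j, f (z i) = f (z j)) (i : Fin n) : z i = c := by
  obtain ⟨hc1, hc2⟩ := abs_le.1 hc
  have hsum : ∑ i, ξ i * (z i - c) = 0 := by
    simp [mul_sub, Finset.sum_sub_distrib, ← Finset.sum_mul, hξ1, hz]
  -- `f` may be flat outside `[-h, h]`, so the two points are clamped to that interval. They stay
  -- distinct because `c` lies in it, and strict monotonicity separates their outputs. Hence the
  -- deviations `z i - c` all have one sign, while their positively weighted sum is zero.
  have key : ∀ i j, z i < c → c < z j → False := by
    intro i j hi hj
    have hlt : max (z i) (-h) < min (z j) h := by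
      refine max_lt (lt_min ?_ ?_) (lt_min ?_ ?_) <;> linarith
    have h1 := hs ⟨le_max_right _ _, hlt.le.trans (min_le_right _ _)⟩
      ⟨(le_max_right _ _).trans hlt.le, min_le_right _ _⟩ hlt
    have h2 : f (z i) ≤ f (max (z i) (-h)) := hf (le_max_left _ _)
    have h3 : f (min (z j) h) ≤ f (z j) := hf (min_le_left _ _)
    linarith [heq i j]
  rcases lt_trichotomy (z i) c with hi | hi | hi
  · refine absurd hsum (ne_of_lt (Finset.sum_neg' (fun j _ => ?_) ⟨i, Finset.mem_univ i, ?_⟩))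
    · exact mul_nonpos_of_nonneg_of_nonpos (hξ j).le
        (sub_nonpos.2 (not_lt.1 fun hj => key i j hi hj))
    · exact mul_neg_of_pos_of_neg (hξ i) (sub_neg.2 hi)
  · exact hi
  · refine absurd hsum (ne_of_gt (Finset.sum_pos' (fun j _ => ?_) ⟨i, Finset.mem_univ i, ?_⟩))
    · exact mul_nonneg (hξ j).le (sub_nonneg.2 (not_lt.1 fun hj => key j i hj hi))
    · exact mul_pos (hξ i) (sub_pos.2 hi)

/-! ### Energy dissipation and convergence of perturbed flows -/

namespace IsPerturbedFlow

variable {G : WeightedDigraph n} {f : ℝ → ℝ} {A b : ℝ} {T : EReal} {y e : Fin n → ℝ → ℝ}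

lemma exists_output_lipschitz (H : IsPerturbedFlow G f A b T y e) (hf : Monotone f)
    (hlip : ∀ S : Set ℝ, IsCompact S → ∃ K : NNReal, LipschitzOnWith K f S)
    (hA : 0 ≤ A) (hb : 0 < b) :
    ∃ K, 0 ≤ K ∧ ∀ i (s r : ℝ), 0 ≤ s → s ≤ r → (r : EReal) < T →
      |f (y i r) - f (y i s)| ≤ K * (r - s) := by
  obtain ⟨R, hR⟩ := H.exists_abs_le hf hA hb
  obtain ⟨V, hV0, hV⟩ := H.exists_lipschitz hf hA hb
  obtain ⟨K, hK⟩ := hlip (Icc (-R) R) isCompact_Icc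
  refine ⟨K * V, by positivity, fun i s r hs hsr hr => ?_⟩
  have hsT : (s : EReal) < T := (EReal.coe_le_coe_iff.2 hsr).trans_lt hr
  have h1 := hK.dist_le_mul _ (abs_le.1 (hR i r (hs.trans hsr) hr)) _ (abs_le.1 (hR i s hs hsT))
  rw [Real.dist_eq, Real.dist_eq] at h1
  rw [mul_assoc]
  exact h1.trans (mul_le_mul_of_nonneg_left (hV i s r hs hsr hr) K.2)

/-- The identity `u i * (u j - u i) = (u j ^ 2 - u i ^ 2) / 2 - (u j - u i) ^ 2 / 2` splits off a
term that `ξ` annihilates. The errors cost at most `F * (2 * D)` per link. -/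
lemma energy_deriv_le {ξ : Fin n → ℝ} (hξ : G.IsLeftWeight ξ) {u v : Fin n → ℝ} {F D : ℝ}
    (hF : ∀ i, |u i| ≤ F) (hv : ∀ i, |v i| ≤ D) :
    ∑ i, ξ i * (u i * ∑ j, G.weight i j * ((u j + v j) - (u i + v i))) ≤
      -(∑ i, ξ i * ∑ j, G.weight i j * (u j - u i) ^ 2) / 2 +
        (∑ i, ξ i * ∑ j, G.weight i j * (2 * F)) * D := by
  have h0 := hξ.sum_mul_sum_weight fun i => u i ^ 2
  -- Adding the vanishing sum of differences of squares makes the inequality hold term by term.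
  have h1 : -(∑ i, ξ i * ∑ j, G.weight i j * (u j - u i) ^ 2) / 2 =
      (∑ i, ξ i * ∑ j, G.weight i j * (u j ^ 2 - u i ^ 2)) / 2 -
        (∑ i, ξ i * ∑ j, G.weight i j * (u j - u i) ^ 2) / 2 := by
    rw [h0]; ring
  rw [h1, ← sub_div, ← Finset.sum_sub_distrib, Finset.sum_div, Finset.sum_mul,
    ← Finset.sum_add_distrib]
  refine Finset.sum_le_sum fun i _ => ?_
  rw [← mul_sub, mul_div_assoc, mul_assoc, ← mul_add]
  refine mul_le_mul_of_nonneg_left ?_ (hξ.nonneg i)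
  rw [← Finset.sum_sub_distrib, Finset.sum_div, Finset.sum_mul, Finset.mul_sum,
    ← Finset.sum_add_distrib]
  refine Finset.sum_le_sum fun j _ => ?_
  have h2 : u i * (v j - v i) ≤ F * (2 * D) := by
    refine (le_abs_self _).trans ?_
    rw [abs_mul]
    refine mul_le_mul (hF i) ?_ (abs_nonneg _) ((abs_nonneg _).trans (hF i))
    exact (abs_sub _ _).trans (by linarith [hv i, hv j])
  have h3 := mul_le_mul_of_nonneg_left h2 (G.weight_nonneg i j)
  nlinarith

lemma tendsto_output_sub (H : IsPerturbedFlow G f A b ⊤ y e) (hG : G.StronglyConnected)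
    (hfc : Continuous f) (hf : Monotone f)
    (hlip : ∀ S : Set ℝ, IsCompact S → ∃ K : NNReal, LipschitzOnWith K f S)
    (hA : 0 ≤ A) (hb : 0 < b) {ξ : Fin n → ℝ} (hξ : G.IsLeftWeight ξ) (i j : Fin n) :
    Tendsto (fun τ => f (y i τ) - f (y j τ)) atTop (𝓝 0) := by
  obtain ⟨R, hR⟩ := H.exists_abs_le hf hA hb
  obtain ⟨F, hF0, hF⟩ := H.exists_output_abs_le hf hA hb
  obtain ⟨K, hK0, hK⟩ := H.exists_output_lipschitz hf hlip hA hb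
  have hsub : Ici (0 : ℝ) ⊆ {τ : ℝ | 0 ≤ τ ∧ (τ : EReal) < ⊤} :=
    fun τ hτ => ⟨hτ, EReal.coe_lt_top τ⟩
  have hw : ∀ {v : Fin n → Fin n → ℝ}, (∀ i j, 0 ≤ v i j) →
      0 ≤ ∑ i, ξ i * ∑ j, G.weight i j * v i j := fun hv =>
    Finset.sum_nonneg fun i _ => mul_nonneg (hξ.nonneg i) <|
      Finset.sum_nonneg fun j _ => mul_nonneg (G.weight_nonneg i j) (hv i j)
  -- A primitive of `f`: along the flow, `E (y i)` has derivative `f (y i)` times the velocity, the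
  -- form treated by `energy_deriv_le`.
  set E : ℝ → ℝ := fun s => ∫ r in (0 : ℝ)..s, f r with hE
  have hEd : ∀ s, HasDerivAt E (f s) s := fun s => (hfc.integral_hasStrictDerivAt 0 s).hasDerivAt
  have hEc : Continuous E := continuous_iff_continuousAt.2 fun s => (hEd s).continuousAt
  set Q : ℝ → ℝ := fun τ => ∑ i, ξ i * ∑ j, G.weight i j * (f (y j τ) - f (y i τ)) ^ 2 with hQ
  have hQ0 : ∀ τ, 0 ≤ Q τ := fun τ => hw fun i j => sq_nonneg _
  obtain ⟨m, hm⟩ := (isCompact_Icc (a := -R) (b := R)).bddBelow_image hEc.continuousOn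
  have hQlim : Tendsto (fun τ => Q τ / 2) atTop (𝓝 0) := by
    refine tendsto_zero_of_deriv_right_le (W := fun τ => ∑ i, ξ i * E (y i τ)) (m := m)
      (W' := fun τ => ∑ i, ξ i * (f (y i τ) *
        ∑ j, G.weight i j * ((f (y j τ) + e j τ) - (f (y i τ) + e i τ))))
      (C := (∑ i, ξ i * ∑ j, G.weight i j * (2 * F)) * A)
      (K := ∑ i, ξ i * ∑ j, G.weight i j * (4 * F * K)) hb ?_ ?_ ?_ ?_ ?_ ?_ ?_ ?_
    · exact continuousOn_finsetSum _ fun i _ => continuousOn_const.mul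
        (hEc.comp_continuousOn ((H.continuousOn i).mono hsub))
    · intro τ hτ
      exact HasDerivWithinAt.fun_sum fun i _ =>
        ((hEd _).comp_hasDerivWithinAt τ (H.deriv_right i τ hτ (EReal.coe_lt_top τ))).const_mul _
    · intro τ hτ
      have := energy_deriv_le hξ (fun i => hF i τ hτ (EReal.coe_lt_top τ))
        (fun i => H.error_le i τ hτ (EReal.coe_lt_top τ))
      rw [← mul_assoc, neg_div] at this
      exact this
    · intro τ hτ
      calc m = ∑ i, ξ i * m := by rw [← Finset.sum_mul, hξ.sum_eq_one, one_mul]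
        _ ≤ _ := Finset.sum_le_sum fun i _ => mul_le_mul_of_nonneg_left
          (hm ⟨_, abs_le.1 (hR i τ hτ (EReal.coe_lt_top τ)), rfl⟩) (hξ.nonneg i)
    · exact fun τ _ => div_nonneg (hQ0 τ) zero_le_two
    · exact mul_nonneg (hw fun _ _ => by positivity) hA
    · exact hw fun _ _ => by positivity
    · intro s r hs hsr
      have hr := hs.trans hsr
      rw [← sub_div, hQ]
      simp only
      rw [← Finset.sum_sub_distrib, Finset.sum_div, Finset.sum_mul]
      refine (Finset.abs_sum_le_sum_abs _ _).trans (Finset.sum_le_sum fun i _ => ?_)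
      rw [← mul_sub, mul_div_assoc, mul_assoc, abs_mul, abs_of_nonneg (hξ.nonneg i)]
      refine mul_le_mul_of_nonneg_left ?_ (hξ.nonneg i)
      rw [← Finset.sum_sub_distrib, Finset.sum_div, Finset.sum_mul]
      refine (Finset.abs_sum_le_sum_abs _ _).trans (Finset.sum_le_sum fun j _ => ?_)
      rw [← mul_sub, mul_div_assoc, mul_assoc, abs_mul, abs_of_nonneg (G.weight_nonneg i j)]
      refine mul_le_mul_of_nonneg_left ?_ (G.weight_nonneg i j)
      have hi := abs_le.1 (hK i s r hs hsr (EReal.coe_lt_top r))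
      have hj := abs_le.1 (hK j s r hs hsr (EReal.coe_lt_top r))
      have hir := abs_le.1 (hF i r hr (EReal.coe_lt_top r))
      have hjr := abs_le.1 (hF j r hr (EReal.coe_lt_top r))
      have his := abs_le.1 (hF i s hs (EReal.coe_lt_top s))
      have hjs := abs_le.1 (hF j s hs (EReal.coe_lt_top s))
      have h1 : |(f (y j r) - f (y i r)) - (f (y j s) - f (y i s))| ≤ 2 * (K * (r - s)) :=
        abs_le.2 ⟨by linarith [hi.2, hj.1], by linarith [hi.1, hj.2]⟩
      have h2 : |(f (y j r) - f (y i r)) + (f (y j s) - f (y i s))| ≤ 4 * F :=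
        abs_le.2 ⟨by linarith [hir.2, hjr.1, his.2, hjs.1],
          by linarith [hir.1, hjr.2, his.1, hjs.2]⟩
      have h3 := mul_le_mul h1 h2 (abs_nonneg _) (by
        have := sub_nonneg.2 hsr
        positivity)
      rw [abs_div, sq_sub_sq, abs_mul, abs_two, mul_comm |_ + _|]
      linarith
  -- Each link contributes a nonnegative summand to `Q` with positive coefficient since `ξ j > 0`.
  -- Chains of links then reach every pair of agents.
  have hlink : ∀ i j, G.Link i j → Tendsto (fun τ => f (y i τ) - f (y j τ)) atTop (𝓝 0) := by
    intro i j hij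
    have hpos : 0 < ξ j * G.weight j i := mul_pos (hξ.pos hG j) hij
    have hsq : Tendsto (fun τ => (f (y i τ) - f (y j τ)) ^ 2) atTop (𝓝 0) := by
      have hup : Tendsto (fun τ => Q τ / 2 * (2 / (ξ j * G.weight j i))) atTop (𝓝 0) := by
        simpa using hQlim.mul_const (2 / (ξ j * G.weight j i))
      refine squeeze_zero (fun _ => sq_nonneg _) (fun τ => ?_) hup
      rw [div_mul_div_cancel₀ two_ne_zero, le_div_iff₀ hpos]
      have h1 : G.weight j i * (f (y i τ) - f (y j τ)) ^ 2 ≤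
          ∑ k, G.weight j k * (f (y k τ) - f (y j τ)) ^ 2 :=
        Finset.single_le_sum (f := fun k => G.weight j k * (f (y k τ) - f (y j τ)) ^ 2)
          (fun k _ => mul_nonneg (G.weight_nonneg j k) (sq_nonneg _)) (Finset.mem_univ i)
      have h2 : ξ j * ∑ k, G.weight j k * (f (y k τ) - f (y j τ)) ^ 2 ≤ Q τ :=
        Finset.single_le_sum
          (f := fun j => ξ j * ∑ k, G.weight j k * (f (y k τ) - f (y j τ)) ^ 2)
          (fun k _ => mul_nonneg (hξ.nonneg k) (Finset.sum_nonneg fun l _ =>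
            mul_nonneg (G.weight_nonneg k l) (sq_nonneg _))) (Finset.mem_univ j)
      have h3 := mul_le_mul_of_nonneg_left h1 (hξ.nonneg j)
      linarith
    have := hsq.sqrt
    simp only [Real.sqrt_sq_eq_abs, Real.sqrt_zero] at this
    exact (tendsto_zero_iff_abs_tendsto_zero _).2 this
  rcases eq_or_ne i j with rfl | hne
  · simp
  · have hij := hG i j hne
    clear hne
    induction hij with
    | single h => exact hlink _ _ h
    | tail _ h ih => simpa using ih.add (hlink _ _ h)

/-- A perturbed flow with weighted average in the region of strict monotonicity converges to it. -/
lemma tendsto_average (H : IsPerturbedFlow G f A b ⊤ y e) (hG : G.StronglyConnected) {h : ℝ}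
    (hh : 0 < h) (hfc : Continuous f) (hf : Monotone f) (hs : StrictMonoOn f (Icc (-h) h))
    (hlip : ∀ S : Set ℝ, IsCompact S → ∃ K : NNReal, LipschitzOnWith K f S)
    (hA : 0 ≤ A) (hb : 0 < b) {ξ : Fin n → ℝ} (hξ : G.IsLeftWeight ξ)
    (hc : |∑ i, ξ i * y i 0| ≤ h) (i : Fin n) :
    Tendsto (y i) atTop (𝓝 (∑ i, ξ i * y i 0)) := by
  obtain ⟨R, hR⟩ := H.exists_abs_le hf hA hb
  suffices hlim : Tendsto (fun τ i => y i τ) atTop (𝓝 fun _ => ∑ i, ξ i * y i 0) from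
    (tendsto_pi_nhds.1 hlim) i
  refine (isCompact_univ_pi fun _ : Fin n =>
    isCompact_Icc (a := -R) (b := R)).tendsto_nhds_of_unique_mapClusterPt ?_ fun z _ hz => ?_
  · filter_upwards [eventually_ge_atTop 0] with τ hτ i _
    exact abs_le.1 (hR i τ hτ (EReal.coe_lt_top τ))
  · obtain ⟨U, hU, hUz⟩ := mapClusterPt_iff_ultrafilter.1 hz
    have hUz' := tendsto_pi_nhds.1 hUz
    funext k
    refine eq_average_of_forall_eq hh hf hs (hξ.pos hG) hξ.sum_eq_one hc ?_ (fun i j => ?_) k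
    · have h1 : Tendsto (fun τ => ∑ i, ξ i * y i τ) U (𝓝 (∑ i, ξ i * z i)) :=
        tendsto_finsetSum _ fun i _ => (hUz' i).const_mul _
      have h2 : Tendsto (fun τ => ∑ i, ξ i * y i τ) U (𝓝 (∑ i, ξ i * y i 0)) := by
        refine tendsto_const_nhds.congr' ?_
        filter_upwards [hU (eventually_ge_atTop 0)] with τ hτ
        exact (H.sum_mul_eq hξ hτ).symm
      exact tendsto_nhds_unique h1 h2
    · have h1 := ((hfc.tendsto _).comp (hUz' i)).sub ((hfc.tendsto _).comp (hUz' j))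
      have h2 := (H.tendsto_output_sub hG hfc hf hlip hA hb hξ i j).mono_left hU
      exact sub_eq_zero.1 (tendsto_nhds_unique h1 h2)

end IsPerturbedFlow

/-! ### Executions: triggering times and reduction to scalar flows -/

lemma continuous_output {g : Fin p → ℝ → ℝ} (hg : ∀ l, Continuous (g l)) :
    Continuous (output g) := by
  unfold output
  fun_prop

namespace IsExecution

variable {G : WeightedDigraph n} {g : Fin p → ℝ → ℝ} {α β : Fin n → ℝ}
  {x : Fin n → ℝ → EuclideanSpace ℝ (Fin p)} {t : Fin n → ℕ → EReal}

lemma monotone (hx : IsExecution G g α β x t) (i : Fin n) : Monotone (t i) := by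
  refine monotone_nat_of_le_succ fun k => ?_
  rcases eq_or_ne (t i k) ⊤ with htop | htop
  · rw [htop, hx.next_top i k htop]
  · have hbot : t i k ≠ ⊥ := by
      induction k with
      | zero => simp [hx.first i]
      | succ k ih =>
        rcases eq_or_ne (t i k) ⊤ with h | h
        · exact absurd (hx.next_top i k h) htop
        · rcases hx.next i k _ (EReal.coe_toReal h (ih h)).symm with ⟨r, -, hr⟩ | ⟨-, hr⟩ <;>
            simp [hr]
    have hs := (EReal.coe_toReal htop hbot).symm
    rcases hx.next i k _ hs with ⟨r, hr, hr'⟩ | ⟨-, hr⟩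
    · rw [hs, hr']
      exact EReal.coe_le_coe_iff.2 hr.1.1
    · rw [hr]
      exact le_top

lemma nonneg (hx : IsExecution G g α β x t) (i : Fin n) (k : ℕ) : 0 ≤ t i k :=
  (hx.first i).symm.le.trans (hx.monotone i (Nat.zero_le k))

lemma exists_coe (hx : IsExecution G g α β x t) {i : Fin n} {k : ℕ} (h : t i k ≠ ⊤) :
    ∃ s : ℝ, 0 ≤ s ∧ t i k = s := by
  have h0 := hx.nonneg i k
  have hs := EReal.coe_toReal h (ne_bot_of_le_ne_bot EReal.zero_ne_bot h0)
  exact ⟨_, EReal.toReal_nonneg h0, hs.symm⟩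

/-- A finite second triggering time is admissible, hence already below the horizon; an infinite one
makes that agent's supremum infinite. Over finitely many agents the infimum is attained. -/
lemma horizon_pos (hx : IsExecution G g α β x t) : 0 < horizon t := by
  have h0 : ∀ i, 0 < ⨆ k, t i k := by
    intro i
    rcases hx.next i 0 0 (hx.first i) with ⟨r, hr, -⟩ | ⟨-, hr⟩
    · exact ((EReal.coe_le_coe_iff.2 hr.1.1).trans_lt hr.1.2.1).trans_le (iInf_le _ i)
    · refine lt_of_lt_of_le ?_ (le_iSup (t i) 1)
      rw [hr]
      exact EReal.zero_lt_top
  rcases isEmpty_or_nonempty (Fin n) with hn | hn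
  · rw [horizon, iInf_of_empty]
    exact EReal.zero_lt_top
  · obtain ⟨i, hi⟩ := exists_eq_ciInf_of_finite (f := fun i => ⨆ k, t i k)
    rw [horizon, ← hi]
    exact h0 i

lemma lt_horizon (hx : IsExecution G g α β x t) {i : Fin n} {k : ℕ} {s : ℝ} (hs : t i k = s) :
    (s : EReal) < horizon t := by
  cases k with
  | zero => rw [← hs, hx.first i]; exact hx.horizon_pos
  | succ k =>
    have hk : t i k ≠ ⊤ := fun h => by simp [hx.next_top i k h] at hs
    obtain ⟨s', -, hs'⟩ := hx.exists_coe hk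
    rcases hx.next i k s' hs' with ⟨r, hr, hr'⟩ | ⟨-, hr⟩
    · rw [hs, EReal.coe_eq_coe_iff] at hr'
      exact hr' ▸ hr.1.2.1
    · simp [hs] at hr

lemma finite_le (hx : IsExecution G g α β x t) (i : Fin n) {S : EReal} (hS : S < horizon t) :
    {k : ℕ | t i k ≤ S}.Finite := by
  obtain ⟨k, hk⟩ := lt_iSup_iff.1 (hS.trans_le (iInf_le _ i))
  exact (finite_lt_nat k).subset fun m hm =>
    not_le.1 fun hkm => (hk.trans_le (hx.monotone i hkm)).not_ge hm

/-- The error between the output at the last triggering time and the present one respects the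
triggering threshold. -/
lemma norm_error_sq_le (hx : IsExecution G g α β x t) (i : Fin n) {τ : ℝ} (h0 : 0 ≤ τ)
    (hτ : (τ : EReal) < horizon t) :
    ‖output g (sampledState (x i) (t i) τ) - output g (x i τ)‖ ^ 2 ≤
      α i * Real.exp (-β i * τ) := by
  -- Finiteness makes `lastIndex` a genuine maximum; the supremum of an unbounded set of naturals
  -- would default to `0`.
  have hfin := hx.finite_le i hτ
  have hmem : lastIndex (t i) τ ∈ {k : ℕ | t i k ≤ (τ : EReal)} :=
    Nat.sSup_mem ⟨0, by simpa [hx.first i] using h0⟩ hfin.bddAbove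
  have hsucc : (τ : EReal) < t i (lastIndex (t i) τ + 1) := not_le.1 fun h =>
    (Nat.lt_succ_self _).not_ge (le_csSup hfin.bddAbove h)
  unfold sampledState
  generalize lastIndex (t i) τ = k at hmem hsucc
  change t i k ≤ τ at hmem
  obtain ⟨s, -, hs⟩ := hx.exists_coe (ne_top_of_le_ne_top (EReal.coe_ne_top τ) hmem)
  rw [hs, EReal.coe_le_coe_iff] at hmem
  rw [hs, EReal.toReal_coe]
  rcases hx.next i k s hs with ⟨r, hr, hr'⟩ | ⟨hall, -⟩
  · rw [hr', EReal.coe_lt_coe_iff] at hsucc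
    exact hr.1.2.2 τ ⟨hmem, hsucc.le⟩
  · exact (hall τ hmem hτ).2.2 τ ⟨hmem, le_rfl⟩

/-- At a triggering time the threshold is attained. -/
lemma threshold_le (hx : IsExecution G g α β x t) (hg : ∀ l, Continuous (g l)) {i : Fin n} {s r : ℝ}
    (hs : 0 ≤ s) (hr : IsGreatest (admissibleTimes g (α i) (β i) (horizon t) (x i) s) r) :
    α i * Real.exp (-β i * r) ≤ ‖output g (x i s) - output g (x i r)‖ ^ 2 := by
  obtain ⟨⟨hsr, hrT, hle⟩, hmax⟩ := hr
  by_contra! hlt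
  -- With strict inequality at `r`, right continuity keeps the bound valid slightly beyond `r`,
  -- still below the horizon, against maximality.
  have hc : ContinuousWithinAt (fun τ => α i * Real.exp (-β i * τ) -
      ‖output g (x i s) - output g (x i τ)‖ ^ 2) (Ici r) r := by
    have h1 : ContinuousWithinAt (fun τ => output g (x i τ)) (Ici r) r :=
      (continuous_output hg).continuousAt.comp_continuousWithinAt
        (hx.deriv_right i r (hs.trans hsr) hrT).continuousWithinAt
    exact (by fun_prop : Continuous fun τ => α i * Real.exp (-β i * τ)).continuousWithinAt.sub
      ((continuousWithinAt_const.sub h1).norm.pow 2)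
  have hev : ∀ᶠ τ in 𝓝[≥] r, 0 ≤ α i * Real.exp (-β i * τ) -
      ‖output g (x i s) - output g (x i τ)‖ ^ 2 :=
    (hc.eventually (lt_mem_nhds (sub_pos.2 hlt))).mono fun _ h => h.le
  obtain ⟨q, hrq, hq⟩ := mem_nhdsGE_iff_exists_Ico_subset.1 hev
  obtain ⟨w, hw1, hw2⟩ := EReal.lt_iff_exists_real_btwn.1 hrT
  have hrw := EReal.coe_lt_coe_iff.1 hw1
  obtain ⟨v, hrv, hv⟩ := exists_between (lt_min hrq hrw)
  refine (hmax (a := v) ⟨hsr.trans hrv.le, ?_, fun τ hτ => ?_⟩).not_gt hrv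
  · exact (EReal.coe_lt_coe_iff.2 (hv.trans_le (min_le_right _ _))).trans hw2
  · rcases le_total τ r with h | h
    · exact hle τ ⟨hτ.1, h⟩
    · exact sub_nonneg.1 (hq ⟨h, (hτ.2.trans_lt hv).trans_le (min_le_left _ _)⟩)

/-- Every coordinate of an execution is a perturbed scalar flow, with common decay constants. -/
lemma exists_isPerturbedFlow (hx : IsExecution G g α β x t) (hβ : ∀ i, 0 < β i) :
    ∃ A b, 0 ≤ A ∧ 0 < b ∧ ∀ l, IsPerturbedFlow G (g l) A b (horizon t) (fun i τ => x i τ l)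
      (fun i τ => g l (sampledState (x i) (t i) τ l) - g l (x i τ l)) := by
  obtain ⟨A, hA⟩ : ∃ A, ∀ i, √(α i) ≤ A := by
    obtain ⟨A, hA⟩ := (finite_range fun i => √(α i)).bddAbove
    exact ⟨A, fun i => hA ⟨i, rfl⟩⟩
  -- The threshold bounds the squared norm, so the decay rate is halved.
  obtain ⟨b, hb0, hb⟩ : ∃ b, 0 < b ∧ ∀ i, b ≤ β i / 2 := by
    rcases isEmpty_or_nonempty (Fin n) with hn | hn
    · exact ⟨1, one_pos, fun i => isEmptyElim i⟩
    · obtain ⟨i, hi⟩ := Finite.exists_min fun i => β i / 2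
      exact ⟨β i / 2, half_pos (hβ i), hi⟩
  refine ⟨max A 0, b, le_max_right _ _, hb0, fun l => ⟨fun i => ?_, fun i τ h0 hτ => ?_,
    fun i τ h0 hτ => ?_⟩⟩
  · exact (EuclideanSpace.proj (𝕜 := ℝ) l).continuous.comp_continuousOn (hx.continuousOn i)
  · have h1 := (EuclideanSpace.proj l : EuclideanSpace ℝ (Fin p) →L[ℝ] ℝ).hasFDerivAt
      |>.comp_hasDerivWithinAt τ (hx.deriv_right i τ h0 hτ)
    refine h1.congr_deriv ?_
    have h2 := G.neg_sum_laplacian_mul (fun j => g l (sampledState (x j) (t j) τ l)) i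
    simp only [add_sub_cancel]
    rw [← h2]
    simp [controlInput, output]
  · have h1 := hx.norm_error_sq_le i h0 hτ
    have h2 := PiLp.norm_apply_le
      (output g (sampledState (x i) (t i) τ) - output g (x i τ)) l
    have h3 := Real.le_sqrt_of_sq_le h1
    have hexp : Real.exp (-β i * τ) = Real.exp (-β i / 2 * τ) ^ 2 := by
      rw [sq, ← Real.exp_add]; ring_nf
    rw [hexp, Real.sqrt_mul' _ (sq_nonneg _), Real.sqrt_sq (Real.exp_pos _).le] at h3
    have h4 : Real.exp (-β i / 2 * τ) ≤ Real.exp (-b * τ) :=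
      Real.exp_le_exp.2 (by nlinarith [hb i])
    have h5 := mul_le_mul ((hA i).trans (le_max_left A 0)) h4 (Real.exp_pos _).le
      (le_max_right A 0)
    exact (h2.trans h3).trans h5

/-! ### Exclusion of Zeno behaviour and the main theorem -/

lemma horizon_eq_top (hx : IsExecution G g α β x t) {h : ℝ} (hg : OutputAssumption g h)
    (hα : ∀ i, 0 < α i) (hβ : ∀ i, 0 < β i) : horizon t = ⊤ := by
  by_contra htop
  obtain ⟨T, hT⟩ : ∃ T : ℝ, horizon t = T :=
    ⟨_, (EReal.coe_toReal htop (ne_bot_of_gt hx.horizon_pos)).symm⟩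
  have hn : Nonempty (Fin n) := by
    by_contra hn
    rw [not_nonempty_iff] at hn
    exact htop (iInf_of_empty _)
  -- This agent's triggering times accumulate at the horizon; all are finite and below `T`.
  obtain ⟨i, hi⟩ := exists_eq_ciInf_of_finite (f := fun i => ⨆ k, t i k)
  change _ = horizon t at hi
  obtain ⟨A, b, hA, hb, H⟩ := hx.exists_isPerturbedFlow hβ
  choose K hK0 hK using fun l => (H l).exists_output_lipschitz (hg.monotone l)
    (hg.locallyLipschitz l) hA hb
  have hcoe : ∀ k, ∃ s : ℝ, 0 ≤ s ∧ t i k = s := fun k => hx.exists_coe fun h =>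
    htop (by rw [← hi]; exact top_unique (h ▸ le_iSup (t i) k))
  choose s hs0 hs using hcoe
  have hsT : ∀ k, s k < T := fun k => by
    rw [← EReal.coe_lt_coe_iff, ← hT]; exact hx.lt_horizon (hs k)
  set D : ℝ := ∑ l, K l ^ 2 with hD
  have hD0 : 0 ≤ D := Finset.sum_nonneg fun l _ => sq_nonneg _
  set c : ℝ := α i * Real.exp (-β i * T) with hc
  have hc0 : 0 < c := mul_pos (hα i) (Real.exp_pos _)
  -- At a trigger the squared output change reaches the threshold, which is at least its value `c`
  -- at time `T`; the coordinatewise Lipschitz bounds on `[0, T)` control that change by the elapsed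
  -- time.
  have hstep : ∀ k, c ≤ D * (s (k + 1) - s k) ^ 2 := by
    intro k
    rcases hx.next i k (s k) (hs k) with ⟨r, hr, hr'⟩ | ⟨-, hr⟩
    · rw [hs, EReal.coe_eq_coe_iff] at hr'
      subst hr'
      have h1 := hx.threshold_le hg.continuous (hs0 k) hr
      have h2 : c ≤ α i * Real.exp (-β i * s (k + 1)) :=
        mul_le_mul_of_nonneg_left (Real.exp_le_exp.2 (by nlinarith [hβ i, hsT (k + 1)])) (hα i).le
      refine h2.trans (h1.trans ?_)
      rw [EuclideanSpace.norm_sq_eq, hD, Finset.sum_mul]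
      refine Finset.sum_le_sum fun l _ => ?_
      have h3 := hK l i (s k) (s (k + 1)) (hs0 k) hr.1.1 hr.1.2.1
      rw [abs_sub_comm] at h3
      rw [← mul_pow]
      exact pow_le_pow_left₀ (norm_nonneg _) h3 2
    · simp [hs] at hr
  have hmono : ∀ k, s k ≤ s (k + 1) := fun k => by
    rw [← EReal.coe_le_coe_iff, ← hs, ← hs]; exact hx.monotone i k.le_succ
  have hDpos : 0 < D := hD0.lt_of_ne fun h => by
    have := hstep 0
    rw [← h, zero_mul] at this
    linarith
  have hdwell : ∀ k, √(c / D) ≤ s (k + 1) - s k := fun k =>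
    Real.sqrt_le_iff.2 ⟨sub_nonneg.2 (hmono k), (div_le_iff₀' hDpos).2 (hstep k)⟩
  have hlin : ∀ k : ℕ, k * √(c / D) ≤ s k := by
    intro k
    induction k with
    | zero => simpa using hs0 0
    | succ k ih => push_cast; linarith [hdwell k]
  obtain ⟨k, hk⟩ := Archimedean.arch T (Real.sqrt_pos.2 (div_pos hc0 hDpos))
  rw [nsmul_eq_mul] at hk
  linarith [hlin k, hsT k]

end IsExecution

end EventTriggered

open EventTriggered

theorem theorem1 {n p : ℕ} (G : EventTriggered.WeightedDigraph n) (hG : G.StronglyConnected)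
    (g : Fin p → ℝ → ℝ) (h : ℝ) (hh : 0 < h) (hg : EventTriggered.OutputAssumption g h)
    (α β : Fin n → ℝ) (hα : ∀ i, 0 < α i) (hβ : ∀ i, 0 < β i)
    (x : Fin n → ℝ → EuclideanSpace ℝ (Fin p)) (t : Fin n → ℕ → EReal)
    (hx : EventTriggered.IsExecution G g α β x t) :
    EventTriggered.NoZeno t ∧
      ∀ ξ : Fin n → ℝ, G.IsLeftWeight ξ →
        (∀ l, |EventTriggered.weightedAverage ξ x 0 l| ≤ h) →
          ∀ i, Filter.Tendsto (x i) Filter.atTop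
            (nhds (EventTriggered.weightedAverage ξ x 0)) := by
  have htop := hx.horizon_eq_top hg hα hβ
  refine ⟨⟨htop, fun i S => hx.finite_le i (htop ▸ EReal.coe_lt_top S)⟩, fun ξ hξ hav i => ?_⟩
  obtain ⟨A, b, hA, hb, H⟩ := hx.exists_isPerturbedFlow hβ
  rw [htop] at H
  have hcoord : ∀ l, weightedAverage ξ x 0 l = ∑ i, ξ i * x i 0 l := fun l => by
    simp [weightedAverage]
  have hlim : ∀ l, Tendsto (fun τ => x i τ l) atTop (𝓝 (weightedAverage ξ x 0 l)) := fun l => by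
    have hl := hav l
    rw [hcoord] at hl ⊢
    exact (H l).tendsto_average hG hh (hg.continuous l) (hg.monotone l) (hg.strictMonoOn l)
      (hg.locallyLipschitz l) hA hb hξ hl i
  exact ((PiLp.continuous_toLp 2 fun _ : Fin p => ℝ).tendsto _).comp (tendsto_pi_nhds.2 hlim)
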